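/- **Theorem 1.** Let $\mathrm{SO}(n)$ be the group of real $n \times n$ matrices $A$ with $A^{\mathsf T}A = I$ and $\det A = 1$, and let $\mathrm{M}(n) = \mathbb{R}^n \rtimes \mathrm{SO}(n)$ be the Euclidean motion group: the set of pairs $(x,A)$ with $x \in \mathbb{R}^n$, $A \in \mathrm{SO}(n)$, with multiplication $(x,A)(y,B) = (x+Ay, AB)$, identity $(0,I)$, the product topology, and the measure $d(x,A)$ that is the product of the Lebesgue measure on $\mathbb{R}^n$ and the Haar measure on $\mathrm{SO}(n)$ of total mass $1$. A bounded measurable function $f\colon \mathrm{M}(n) \to \mathbb{C}$ is of *positive type* if $f(x,A) = \overline{f((x,A)^{-1})}$ for all $(x,A) \in \mathrm{M}(n)$ and $$\int_{\mathrm{M}(n)} \int_{\mathrm{M}(n)} f((y,B)^{-1}(x,A))\, \rho(x,A)\, \overline{\rho(y,B)}\, d(y,B)\, d(x,A) \ge 0 \quad \text{for all } \rho \in L^1(\mathrm{M}(n)).$$ Let $K \subseteq \mathbb{R}^n$ be a convex body with interior $K^\circ$, and let $f \in L^1(\mathrm{M}(n))$ be a bounded real-valued function such that 1. $f$ is continuous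 and of positive type; 2. $f(x,A) \le 0$ whenever $K^\circ \cap (x + AK^\circ) = \emptyset$; 3. $\lambda = \int_{\mathrm{M}(n)} f(x,A)\, d(x,A) > 0$. Let $P$ be a packing of congruent copies of $K$, that is, a union of sets $x + AK$ with $(x,A) \in \mathrm{M}(n)$ whose interiors are pairwise disjoint. Then the upper density of $P$ satisfies $$\limsup_{r \to \infty} \sup_{p \in \mathbb{R}^n} \frac{\operatorname{vol}(B(p,r) \cap P)}{\operatorname{vol} B(p,r)} \le \frac{f(0,I)}{\lambda} \operatorname{vol} K,$$ where $B(p,r)$ is the ball of radius $r$ centered at $p$. In particular, if $P$ has density $\Delta$, i.e. $\Delta = \lim_{r\to\infty} \operatorname{vol}(B(p,r) \cap P)/\operatorname{vol} B(p,r)$ for all $p \in \mathbb{R}^n$, then $\Delta \le \frac{f(0,I)}{\lambda} \operatorname{vol} K$. -/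

import Mathlib

open MeasureTheory Filter
open scoped Pointwise ComplexOrder ENNReal

noncomputable section

/-- Euclidean space `ℝⁿ`. -/
abbrev EuclN (n : ℕ) : Type := EuclideanSpace ℝ (Fin n)

/-- The rotation group `SO(n)`: real `n × n` matrices with `Aᵀ A = I` and `det A = 1`, with the
topology inherited from the space of matrices. -/
abbrev SOrth (n : ℕ) : Type := Matrix.specialOrthogonalGroup (Fin n) ℝ

namespace SOrth

variable {n : ℕ}

lemma transpose_mul_self (A : SOrth n) : A.1.transpose * A.1 = 1 :=
  (Matrix.mem_orthogonalGroup_iff' _ _).1 (Matrix.mem_specialOrthogonalGroup_iff.1 A.2).1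

lemma coe_inv (A : SOrth n) : (A⁻¹).1 = A.1.transpose := rfl

instance : IsTopologicalGroup (SOrth n) where
  continuous_inv := by
    refine Continuous.subtype_mk ?_ _
    exact continuous_subtype_val.matrix_transpose

lemma isCompact_carrier :
    IsCompact (Matrix.specialOrthogonalGroup (Fin n) ℝ : Set (Matrix (Fin n) (Fin n) ℝ)) := by
  have hK : IsCompact (Set.pi Set.univ fun _ : Fin n => Set.pi Set.univ fun _ : Fin n =>
      Set.Icc (-1 : ℝ) 1) :=
    isCompact_univ_pi fun _ => isCompact_univ_pi fun _ => isCompact_Icc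
  have hS : (Matrix.specialOrthogonalGroup (Fin n) ℝ : Set (Matrix (Fin n) (Fin n) ℝ)) =
      {A | A.transpose * A = 1 ∧ A.det = 1} := by
    ext A
    rw [SetLike.mem_coe, Matrix.mem_specialOrthogonalGroup_iff, Matrix.mem_orthogonalGroup_iff']
    rfl
  refine IsCompact.of_isClosed_subset hK ?_ ?_
  · rw [hS]
    refine IsClosed.inter ?_ ?_
    · exact isClosed_eq (continuous_id.matrix_transpose.matrix_mul continuous_id) continuous_const
    · exact isClosed_eq continuous_id.matrix_det continuous_const
  · rw [hS]
    rintro A ⟨hA, -⟩ i - j -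
    have h : ∑ k, A k j * A k j = 1 := by
      have := congrFun (congrFun hA j) j
      simpa [Matrix.mul_apply] using this
    have h2 : A i j * A i j ≤ 1 := by
      rw [← h]
      exact Finset.single_le_sum (f := fun k => A k j * A k j)
        (fun k _ => mul_self_nonneg _) (Finset.mem_univ i)
    exact abs_le.1 (abs_le_one_iff_mul_self_le_one.2 h2)

instance : CompactSpace (SOrth n) := isCompact_iff_compactSpace.1 isCompact_carrier

instance : MeasurableSpace (SOrth n) := borel _

instance : BorelSpace (SOrth n) := ⟨rfl⟩

/-- The Haar measure of `SO(n)`, normalized so that `SO(n)` has total measure `1`. -/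
instance : MeasureSpace (SOrth n) := ⟨Measure.haarMeasure ⊤⟩

/-- The rotation `x ↦ A x` of `ℝⁿ`. -/
def rot (A : SOrth n) (x : EuclN n) : EuclN n := WithLp.toLp 2 (A.1.mulVec x.ofLp)

lemma rot_add (A : SOrth n) (x y : EuclN n) : rot A (x + y) = rot A x + rot A y := by
  simp [rot, Matrix.mulVec_add]

lemma rot_neg (A : SOrth n) (x : EuclN n) : rot A (-x) = -rot A x := by
  simp [rot, Matrix.mulVec_neg]

lemma rot_mul (A B : SOrth n) (x : EuclN n) : rot (A * B) x = rot A (rot B x) := by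
  simp [rot]

lemma rot_one (x : EuclN n) : rot 1 x = x := by
  simp [rot]

end SOrth

/-- The Euclidean motion group `M(n) = ℝⁿ ⋊ SO(n)`; the pair `(x, A)` is the motion
`v ↦ x + A v` of `ℝⁿ`. -/
def MotionGroup (n : ℕ) : Type := EuclN n × SOrth n

namespace MotionGroup

variable {n : ℕ}

/-- `(x, A) (y, B) = (x + A y, A B)`. -/
instance : Mul (MotionGroup n) := ⟨fun g h => (g.1 + g.2.rot h.1, g.2 * h.2)⟩

/-- The identity is `(0, I)`. -/
instance : One (MotionGroup n) := ⟨((0 : EuclN n), (1 : SOrth n))⟩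

/-- `(x, A)⁻¹ = (-A⁻¹ x, A⁻¹)`. -/
instance : Inv (MotionGroup n) := ⟨fun g => (-(g.2⁻¹).rot g.1, g.2⁻¹)⟩

instance : Group (MotionGroup n) :=
  Group.ofLeftAxioms
    (fun g h k => Prod.ext
      (by change g.1 + g.2.rot h.1 + (g.2 * h.2).rot k.1 = g.1 + g.2.rot (h.1 + h.2.rot k.1)
          rw [SOrth.rot_add, SOrth.rot_mul, add_assoc])
      (mul_assoc g.2 h.2 k.2))
    (fun g => Prod.ext
      (by change 0 + (1 : SOrth n).rot g.1 = g.1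
          rw [SOrth.rot_one, zero_add])
      (one_mul g.2))
    (fun g => Prod.ext
      (by change -(g.2⁻¹).rot g.1 + (g.2⁻¹).rot g.1 = 0
          exact neg_add_cancel _)
      (inv_mul_cancel g.2))

/-- The action on `ℝⁿ`: `(x, A) • v = x + A v`, so that `(x, A) • K = x + A K`. -/
instance : MulAction (MotionGroup n) (EuclN n) where
  smul g v := g.1 + g.2.rot v
  one_smul v := by
    change 0 + (1 : SOrth n).rot v = v
    rw [SOrth.rot_one, zero_add]
  mul_smul g h v := by
    change g.1 + g.2.rot h.1 + (g.2 * h.2).rot v = g.1 + g.2.rot (h.1 + h.2.rot v)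
    rw [SOrth.rot_add, SOrth.rot_mul, add_assoc]

/-- The product topology. -/
instance : TopologicalSpace (MotionGroup n) := inferInstanceAs (TopologicalSpace (EuclN n × SOrth n))

/-- The product measure `d(x, A)` of the Lebesgue measure and the normalized Haar measure. -/
instance : MeasureSpace (MotionGroup n) := inferInstanceAs (MeasureSpace (EuclN n × SOrth n))

/-- A bounded measurable function `f : M(n) → ℂ` is of positive type if `f g = conj (f g⁻¹)` for all
`g`, and `∫∫ f (h⁻¹ g) ρ(g) conj (ρ(h)) dh dg ≥ 0` (real and nonnegative) for all `ρ ∈ L¹`. -/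
structure IsPositiveType (f : MotionGroup n → ℂ) : Prop where
  aestronglyMeasurable : AEStronglyMeasurable f volume
  bounded : ∃ C : ℝ, ∀ g, ‖f g‖ ≤ C
  hermitian : ∀ g, f g = (starRingEnd ℂ) (f g⁻¹)
  nonneg : ∀ ρ : MotionGroup n → ℂ, Integrable ρ volume →
    0 ≤ ∫ g, ∫ h, f (h⁻¹ * g) * ρ g * (starRingEnd ℂ) (ρ h)

end MotionGroup

/-- `P ⊆ ℝⁿ` is a packing of congruent copies of `K`: a union of copies `x + A K`, `(x, A) ∈ M(n)`,
with pairwise disjoint interiors. -/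
def IsPacking {n : ℕ} (K P : Set (EuclN n)) : Prop :=
  ∃ S : Set (MotionGroup n),
    S.PairwiseDisjoint (fun g => interior (g • K)) ∧ P = ⋃ g ∈ S, g • K

/-- `P` has density `Δ`: for every center `p`, the fraction of the ball `B(p, r)` covered by `P`
tends to `Δ` as `r → ∞`. -/
def HasDensity {n : ℕ} (P : Set (EuclN n)) (Δ : ℝ≥0∞) : Prop :=
  ∀ p : EuclN n, Tendsto
    (fun r : ℝ => volume (Metric.ball p r ∩ P) / volume (Metric.ball p r)) atTop (nhds Δ)

/-- The upper density of `P`: the limsup, as `r → ∞`, of the supremum over all centers `p` of the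
fraction of the ball `B(p, r)` covered by `P`. -/
def upperDensity {n : ℕ} (P : Set (EuclN n)) : ℝ≥0∞ :=
  limsup (fun r : ℝ =>
    ⨆ p : EuclN n, volume (Metric.ball p r ∩ P) / volume (Metric.ball p r)) atTop

end

/-!
A linear-programming bound, proved by testing positive definiteness on one signed density.

Write `k g h = f (h⁻¹ * g)`, a continuous bounded symmetric kernel on `M(n)` whose quadratic form is
nonnegative on `L¹`. Let `F` be the finite set of those motions of the packing whose copy of `K`
meets `B(p, r)` (it is finite, because the bound below holds for each of its finite subsets). Let
`N = #F`, and let `B` be the cylinder `B(p, R) × SO(n)`, where `R - r` is a large constant.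
Approximating point masses by normalized indicators of small open sets, one may test the quadratic
form on `∑ a ∈ F, δ_a - t 1_B`.

* The point masses contribute at most `N f(1)`: for `a ≠ b` the interiors of the copies are disjoint,
  so `f (b⁻¹ * a) ≤ 0`.
* By left invariance `∫ f (h⁻¹ * g) dg = λ` for every `h`, and since `|f|` has little mass on motions
  with a long translation part, the integral over `B` alone is within `ε` of `λ` as soon as `h` lies
  well inside `B`. Hence the cross terms are at most `-2 t N (λ - ε)`, and the last term is at most
  `t² β` with `β = (λ + ε) vol B(p, R)` plus `∫ |f|` times the volume of a boundary shell.

Optimizing over `t` gives `N (λ - ε)² ≤ f(1) β` (`PositiveKernel.card_mul_sq_le` for an abstract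
kernel, `MotionGroup.card_mul_sq_le` for the one at hand). The shell is negligible compared with
`r ^ n`, so letting `r → ∞` and then `ε → 0` bounds `N vol K / vol B(p, r)`, uniformly in `p`, by
`f(1) / λ * vol K`.
-/

/-! ### Positive kernels -/

namespace PositiveKernel

variable {G : Type*} [TopologicalSpace G] [MeasurableSpace G] [OpensMeasurableSpace G]
  [SecondCountableTopology G] {μ : Measure G} {k : G → G → ℝ}

lemma integrable_mul (hk : Continuous (Function.uncurry k)) (hbdd : ∃ C : ℝ, ∀ g h, |k g h| ≤ C)
    {φ ψ : G → ℝ} (hφ : Integrable φ μ) (hψ : Integrable ψ μ) :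
    Integrable (fun z : G × G => k z.1 z.2 * (φ z.1 * ψ z.2)) (μ.prod μ) := by
  obtain ⟨C, hC⟩ := hbdd
  refine (hφ.mul_prod hψ).bdd_mul (c := C) ?_ (ae_of_all _ fun z => hC z.1 z.2)
  exact hk.measurable.aestronglyMeasurable

/-- Lower bound for the cross terms of the quadratic form: if `σ` is carried by `W`, and the
`k`-mass of `B` seen from every point of `W` is at least `α`, then `1_B` and `σ` pair to at least
`α ∫ σ`. -/
lemma integral_indicator_mul_ge [SigmaFinite μ] (hk : Continuous (Function.uncurry k))
    (hbdd : ∃ C : ℝ, ∀ g h, |k g h| ≤ C) {σ : G → ℝ} (hσ : Integrable σ μ) (hσ0 : ∀ g, 0 ≤ σ g)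
    {W B : Set G} (hσW : ∀ g, g ∉ W → σ g = 0) (hB : MeasurableSet B) (hBfin : μ B ≠ ∞)
    {α : ℝ} (hα : ∀ h ∈ W, α ≤ ∫ g in B, k g h ∂μ) :
    α * ∫ g, σ g ∂μ ≤
      ∫ z : G × G, k z.1 z.2 * (B.indicator 1 z.1 * σ z.2) ∂(μ.prod μ) := by
  have hβ : Integrable (B.indicator (1 : G → ℝ)) μ :=
    (integrable_indicator_iff hB).2 (integrableOn_const hBfin)
  have hint := integrable_mul hk hbdd hβ hσ
  rw [integral_prod_symm _ hint, ← integral_const_mul]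
  refine integral_mono (hσ.const_mul α) hint.integral_prod_right fun h => ?_
  have heq : (∫ g, k g h * (B.indicator 1 g * σ h) ∂μ) = (∫ g in B, k g h ∂μ) * σ h := by
    rw [← integral_indicator hB, ← integral_mul_const]
    refine integral_congr_ae (ae_of_all _ fun g => ?_)
    by_cases hg : g ∈ B <;> simp [hg]
  simp only [heq]
  by_cases hh : h ∈ W
  · exact mul_le_mul_of_nonneg_right (hα h hh) (hσ0 h)
  · simp [hσW h hh]

lemma integral_indicator_mul_indicator_le [SigmaFinite μ] (hk : Continuous (Function.uncurry k))
    (hbdd : ∃ C : ℝ, ∀ g h, |k g h| ≤ C) {U V : Set G} (hU : MeasurableSet U)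
    (hV : MeasurableSet V) (hUfin : μ U ≠ ∞) (hVfin : μ V ≠ ∞) {c : ℝ}
    (hc : ∀ g ∈ U, ∀ h ∈ V, k g h ≤ c) :
    ∫ z : G × G, k z.1 z.2 * (U.indicator 1 z.1 * V.indicator 1 z.2) ∂(μ.prod μ) ≤
      c * (μ.real U * μ.real V) := by
  have hu : Integrable (U.indicator (1 : G → ℝ)) μ :=
    (integrable_indicator_iff hU).2 (integrableOn_const hUfin)
  have hv : Integrable (V.indicator (1 : G → ℝ)) μ :=
    (integrable_indicator_iff hV).2 (integrableOn_const hVfin)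
  calc _ ≤ ∫ z : G × G, c * (U.indicator 1 z.1 * V.indicator 1 z.2) ∂(μ.prod μ) := by
        refine integral_mono (integrable_mul hk hbdd hu hv) ((hu.mul_prod hv).const_mul c)
          fun z => ?_
        by_cases h1 : z.1 ∈ U <;> by_cases h2 : z.2 ∈ V <;> simp [h1, h2]
        exact hc _ h1 _ h2
    _ = _ := by
        rw [integral_const_mul, integral_prod_mul, integral_indicator_one hU,
          integral_indicator_one hV]

/-- An integrable substitute `σ` for the sum of the point masses at the points of `F`: a sum of
normalized indicators of small open neighbourhoods. By continuity of `k`, the quadratic form at `σ`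
exceeds its value `∑ a, ∑ b, k a b` at the point masses by at most `η` per term. -/
lemma exists_bump [SigmaFinite μ] [IsLocallyFiniteMeasure μ] [μ.IsOpenPosMeasure]
    (hk : Continuous (Function.uncurry k))
    (hbdd : ∃ C : ℝ, ∀ g h, |k g h| ≤ C) (F : Finset G) {W : Set G} (hW : IsOpen W)
    (hFW : ∀ a ∈ F, a ∈ W) {η : ℝ} (hη : 0 < η) :
    ∃ σ : G → ℝ, Integrable σ μ ∧ (∀ g, 0 ≤ σ g) ∧ (∀ g, g ∉ W → σ g = 0) ∧
      ∫ g, σ g ∂μ = F.card ∧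
      ∫ z : G × G, k z.1 z.2 * (σ z.1 * σ z.2) ∂(μ.prod μ) ≤
        ∑ a ∈ F, ∑ b ∈ F, (k a b + η) := by
  have hnhds : ∀ a b : G, ∃ U V : Set G, IsOpen U ∧ IsOpen V ∧ a ∈ U ∧ b ∈ V ∧
      ∀ g ∈ U, ∀ h ∈ V, k g h ≤ k a b + η := by
    intro a b
    have ho : IsOpen (Function.uncurry k ⁻¹' Set.Iio (k a b + η)) := isOpen_Iio.preimage hk
    obtain ⟨U, V, hU, hV, ha, hb, hUV⟩ :=
      isOpen_prod_iff.1 ho a b (by simpa using hη)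
    exact ⟨U, V, hU, hV, ha, hb, fun g hg h hh => (hUV (Set.mk_mem_prod hg hh)).le⟩
  choose L R hLo hRo hL hR hLR using hnhds
  have hfin : ∀ a : G, ∃ T, a ∈ T ∧ IsOpen T ∧ μ T < ∞ := fun a => μ.exists_isOpen_measure_lt_top a
  choose T haT hTo hTfin using hfin
  -- `U a` lies in `W` and has finite measure, and `k ≤ k a b + η` on `U a ×ˢ U b` for `a, b ∈ F`.
  let U : G → Set G := fun a => W ∩ T a ∩ ⋂ b ∈ F, (L a b ∩ R b a)
  have hUo : ∀ a, IsOpen (U a) := fun a =>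
    (hW.inter (hTo a)).inter (isOpen_biInter_finset fun b _ => (hLo a b).inter (hRo b a))
  have haU : ∀ a ∈ F, a ∈ U a := fun a ha =>
    ⟨⟨hFW a ha, haT a⟩, by simpa using fun b _ => ⟨hL a b, hR b a⟩⟩
  have hUfin : ∀ a, μ (U a) ≠ ∞ := fun a =>
    ((measure_mono (fun x hx => hx.1.2)).trans_lt (hTfin a)).ne
  have hUpos : ∀ a ∈ F, 0 < μ.real (U a) := fun a ha =>
    ENNReal.toReal_pos ((hUo a).measure_pos μ ⟨a, haU a ha⟩).ne' (hUfin a)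
  have hUm : ∀ a, MeasurableSet (U a) := fun a => (hUo a).measurableSet
  have hind : ∀ a, Integrable ((U a).indicator (1 : G → ℝ)) μ := fun a =>
    (integrable_indicator_iff (hUm a)).2 (integrableOn_const (hUfin a))
  refine ⟨fun g => ∑ a ∈ F, (μ.real (U a))⁻¹ * (U a).indicator 1 g, ?_, ?_, ?_, ?_, ?_⟩
  · exact integrable_finsetSum _ fun a _ => (hind a).const_mul _
  · exact fun g => Finset.sum_nonneg fun a _ =>
      mul_nonneg (inv_nonneg.2 measureReal_nonneg) (Set.indicator_nonneg (by simp) _)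
  · intro g hg
    refine Finset.sum_eq_zero fun a _ => ?_
    rw [Set.indicator_of_notMem (fun h => hg h.1.1), mul_zero]
  · rw [integral_finsetSum _ fun a _ => (hind a).const_mul _]
    rw [Finset.sum_congr rfl (g := fun _ => (1 : ℝ))]
    · simp
    · intro a ha
      rw [integral_const_mul, integral_indicator_one (hUm a), inv_mul_cancel₀ (hUpos a ha).ne']
  · have hexp : ∀ z : G × G, k z.1 z.2 * ((∑ a ∈ F, (μ.real (U a))⁻¹ * (U a).indicator 1 z.1) *
        ∑ a ∈ F, (μ.real (U a))⁻¹ * (U a).indicator 1 z.2) =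
        ∑ a ∈ F, ∑ b ∈ F, (μ.real (U a))⁻¹ * (μ.real (U b))⁻¹ *
          (k z.1 z.2 * ((U a).indicator 1 z.1 * (U b).indicator 1 z.2)) := by
      intro z
      rw [Finset.sum_mul_sum, Finset.mul_sum]
      refine Finset.sum_congr rfl fun a _ => ?_
      rw [Finset.mul_sum]
      exact Finset.sum_congr rfl fun b _ => by ring
    have hi : ∀ a b, Integrable (fun z : G × G => (μ.real (U a))⁻¹ * (μ.real (U b))⁻¹ *
          (k z.1 z.2 * ((U a).indicator 1 z.1 * (U b).indicator 1 z.2))) (μ.prod μ) := fun a b =>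
      (integrable_mul hk hbdd (hind a) (hind b)).const_mul _
    simp only [hexp]
    rw [integral_finsetSum _ fun a _ => integrable_finsetSum _ fun b _ => hi a b]
    refine Finset.sum_le_sum fun a ha => ?_
    rw [integral_finsetSum _ fun b _ => hi a b]
    refine Finset.sum_le_sum fun b hb => ?_
    rw [integral_const_mul]
    have hle := integral_indicator_mul_indicator_le hk hbdd (hUm a) (hUm b) (hUfin a) (hUfin b)
      (c := k a b + η) fun g hg h hh => hLR a b g
        (Set.mem_iInter₂.1 hg.2 b hb).1 h (Set.mem_iInter₂.1 hh.2 a ha).2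
    have hpa := hUpos a ha
    have hpb := hUpos b hb
    calc _ ≤ (μ.real (U a))⁻¹ * (μ.real (U b))⁻¹ *
          ((k a b + η) * (μ.real (U a) * μ.real (U b))) :=
          mul_le_mul_of_nonneg_left hle (by positivity)
      _ = k a b + η := by field_simp

/-- The counting inequality for a positive kernel. The quadratic form of `k` is nonnegative at
`∑ a ∈ F, δ_a - t 1_B`, so that `0 ≤ N c - 2 t N α + t² β` with `N = #F`; the bound comes from the
`t` that minimizes the right-hand side. -/
lemma card_mul_sq_le [SigmaFinite μ] [IsLocallyFiniteMeasure μ] [μ.IsOpenPosMeasure]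
    (hk : Continuous (Function.uncurry k)) (hbdd : ∃ C : ℝ, ∀ g h, |k g h| ≤ C)
    (hsymm : ∀ g h, k g h = k h g)
    (hpos : ∀ ρ : G → ℝ, Integrable ρ μ →
      0 ≤ ∫ z : G × G, k z.1 z.2 * (ρ z.1 * ρ z.2) ∂(μ.prod μ))
    {F : Finset G} (hF : F.Nonempty) {c : ℝ} (hdiag : ∀ a ∈ F, k a a ≤ c)
    (hoff : ∀ a ∈ F, ∀ b ∈ F, a ≠ b → k a b ≤ 0)
    {W B : Set G} (hW : IsOpen W) (hFW : ∀ a ∈ F, a ∈ W) (hB : MeasurableSet B)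
    (hBfin : μ B ≠ ∞) {α β : ℝ} (hα0 : 0 ≤ α) (hα : ∀ h ∈ W, α ≤ ∫ g in B, k g h ∂μ)
    (hβ0 : 0 < β) (hβ : ∫ h in B, ∫ g in B, k g h ∂μ ∂μ ≤ β) :
    F.card * α ^ 2 ≤ c * β := by
  classical
  set N : ℝ := (F.card : ℝ) with hN
  have hN0 : 0 < N := by simpa [hN] using hF
  -- The minimizer of `t ↦ N * c - 2 * t * N * α + t ^ 2 * β`.
  set t : ℝ := N * α / β with ht
  have ht0 : 0 ≤ t := by positivity
  have key : ∀ η : ℝ, 0 < η → 0 ≤ N * c - 2 * t * N * α + t ^ 2 * β + N * N * η := by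
    intro η hη
    obtain ⟨σ, hσ, hσ0, hσW, hσN, hσσ⟩ := exists_bump (μ := μ) hk hbdd F hW hFW hη
    have hone : Integrable (B.indicator (1 : G → ℝ)) μ :=
      (integrable_indicator_iff hB).2 (integrableOn_const hBfin)
    have h1 := integral_indicator_mul_ge hk hbdd hσ hσ0 hσW hB hBfin hα
    have h2 : ∫ z : G × G, k z.1 z.2 * (σ z.1 * B.indicator 1 z.2) ∂(μ.prod μ) =
        ∫ z : G × G, k z.1 z.2 * (B.indicator 1 z.1 * σ z.2) ∂(μ.prod μ) := by
      rw [← integral_prod_swap]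
      refine integral_congr_ae (ae_of_all _ fun z => ?_)
      simp only [Prod.fst_swap, Prod.snd_swap]
      rw [hsymm, mul_comm (σ _)]
    have h3 : ∫ z : G × G, k z.1 z.2 * (B.indicator 1 z.1 * B.indicator 1 z.2) ∂(μ.prod μ)
        ≤ β := by
      refine le_trans (le_of_eq ?_) hβ
      rw [integral_prod_symm _ (integrable_mul hk hbdd hone hone), ← integral_indicator hB]
      refine integral_congr_ae (ae_of_all _ fun h => ?_)
      by_cases hh : h ∈ B
      · simp only [hh, Set.indicator_of_mem, ← integral_indicator hB]
        refine integral_congr_ae (ae_of_all _ fun g => ?_)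
        by_cases hg : g ∈ B <;> simp [hg]
      · simp [hh]
    -- Off-diagonal terms are nonpositive, so only the `N` diagonal terms count.
    have h4 : ∑ a ∈ F, ∑ b ∈ F, (k a b + η) ≤ N * c + N * N * η := by
      have : ∀ a ∈ F, ∑ b ∈ F, (k a b + η) ≤ c + N * η := by
        intro a ha
        rw [Finset.sum_add_distrib, Finset.sum_const, nsmul_eq_mul]
        refine add_le_add ?_ le_rfl
        rw [← Finset.add_sum_erase F _ ha]
        have := Finset.sum_nonpos (s := F.erase a) (f := fun b => k a b) fun b hb =>
          hoff a ha b (Finset.mem_of_mem_erase hb) (Finset.ne_of_mem_erase hb).symm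
        linarith [hdiag a ha]
      refine (Finset.sum_le_sum this).trans (le_of_eq ?_)
      rw [Finset.sum_const, nsmul_eq_mul]
      ring
    have h5 := hpos (fun g => σ g - t * B.indicator 1 g) (hσ.sub (hone.const_mul t))
    have e : ∀ z : G × G, k z.1 z.2 * ((σ z.1 - t * B.indicator 1 z.1) *
        (σ z.2 - t * B.indicator 1 z.2)) =
        k z.1 z.2 * (σ z.1 * σ z.2) - t * (k z.1 z.2 * (σ z.1 * B.indicator 1 z.2))
          - t * (k z.1 z.2 * (B.indicator 1 z.1 * σ z.2))
          + t ^ 2 * (k z.1 z.2 * (B.indicator 1 z.1 * B.indicator 1 z.2)) := fun z => by ring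
    have i1 := integrable_mul hk hbdd hσ hσ
    have i2 := (integrable_mul hk hbdd hσ hone).const_mul t
    have i3 := (integrable_mul hk hbdd hone hσ).const_mul t
    have i4 := (integrable_mul hk hbdd hone hone).const_mul (t ^ 2)
    simp only [e] at h5
    have i12 := i1.sub i2
    have i123 := i12.sub i3
    simp only [Pi.sub_def] at i12 i123
    rw [integral_add i123 i4, integral_sub i12 i3, integral_sub i1 i2,
      integral_const_mul, integral_const_mul, integral_const_mul, h2] at h5
    rw [hσN] at h1
    have h6 := mul_le_mul_of_nonneg_left h1 ht0
    have h7 := mul_le_mul_of_nonneg_left h3 (sq_nonneg t)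
    linarith
  have key0 : 0 ≤ N * c - 2 * t * N * α + t ^ 2 * β := by
    refine le_of_forall_pos_le_add fun ε hε => ?_
    have := key (ε / (N * N)) (by positivity)
    rwa [mul_div_cancel₀ _ (by positivity)] at this
  have e : N * c - 2 * t * N * α + t ^ 2 * β = N / β * (c * β - N * α ^ 2) := by
    rw [ht]; field_simp; ring
  rw [e] at key0
  have := nonneg_of_mul_nonneg_right key0 (by positivity)
  linarith

end PositiveKernel

/-! ### The Euclidean motion group: isometric action, topology and Haar measure -/

namespace SOrth

variable {n : ℕ}

lemma norm_rot (A : SOrth n) (x : EuclN n) : ‖A.rot x‖ = ‖x‖ := by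
  have h : ‖A.rot x‖ ^ 2 = ‖x‖ ^ 2 := by
    rw [← real_inner_self_eq_norm_sq, ← real_inner_self_eq_norm_sq]
    simp only [EuclideanSpace.inner_eq_star_dotProduct, rot, star_trivial]
    rw [Matrix.dotProduct_mulVec, Matrix.vecMul_mulVec, transpose_mul_self, Matrix.vecMul_one]
  exact (sq_eq_sq₀ (norm_nonneg _) (norm_nonneg _)).1 h

lemma rot_smul (A : SOrth n) (c : ℝ) (x : EuclN n) : A.rot (c • x) = c • A.rot x := by
  simp [rot, Matrix.mulVec_smul]

/-- A rotation as a linear isometric equivalence of `ℝⁿ`, with inverse the inverse rotation. -/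
noncomputable def rotIsometry (A : SOrth n) : EuclN n ≃ₗᵢ[ℝ] EuclN n where
  toFun := A.rot
  invFun := A⁻¹.rot
  map_add' := A.rot_add
  map_smul' := A.rot_smul
  left_inv x := by rw [← rot_mul, inv_mul_cancel, rot_one]
  right_inv x := by rw [← rot_mul, mul_inv_cancel, rot_one]
  norm_map' := A.norm_rot

lemma continuous_rot : Continuous fun p : SOrth n × EuclN n => p.1.rot p.2 := by
  unfold rot
  refine (PiLp.continuous_toLp 2 _).comp ?_
  exact (continuous_subtype_val.comp continuous_fst).matrix_mulVec
    ((PiLp.continuous_ofLp 2 _).comp continuous_snd)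

instance : SecondCountableTopology (Matrix (Fin n) (Fin n) ℝ) :=
  inferInstanceAs (SecondCountableTopology (Fin n → Fin n → ℝ))

instance : SecondCountableTopology (SOrth n) :=
  TopologicalSpace.Subtype.secondCountableTopology _

instance : (volume : Measure (SOrth n)).IsHaarMeasure :=
  inferInstanceAs (Measure.haarMeasure ⊤).IsHaarMeasure

instance : IsProbabilityMeasure (volume : Measure (SOrth n)) :=
  ⟨Measure.haarMeasure_self (K₀ := (⊤ : TopologicalSpace.PositiveCompacts (SOrth n)))⟩

end SOrth

namespace MotionGroup

variable {n : ℕ}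

lemma smul_def (g : MotionGroup n) (v : EuclN n) : g • v = g.1 + g.2.rot v := rfl

instance : IsTopologicalGroup (MotionGroup n) where
  continuous_mul := by
    change Continuous fun p : (EuclN n × SOrth n) × (EuclN n × SOrth n) =>
      (p.1.1 + p.1.2.rot p.2.1, p.1.2 * p.2.2)
    refine Continuous.prodMk ?_ (by fun_prop)
    exact (by fun_prop : Continuous fun p : (EuclN n × SOrth n) × (EuclN n × SOrth n) => p.1.1).add
      (SOrth.continuous_rot.comp (by fun_prop :
        Continuous fun p : (EuclN n × SOrth n) × (EuclN n × SOrth n) => (p.1.2, p.2.1)))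
  continuous_inv := by
    change Continuous fun p : EuclN n × SOrth n => (-(p.2⁻¹).rot p.1, p.2⁻¹)
    refine Continuous.prodMk ?_ (by fun_prop)
    exact (SOrth.continuous_rot.comp (by fun_prop :
        Continuous fun p : EuclN n × SOrth n => (p.2⁻¹, p.1))).neg

instance : SecondCountableTopology (MotionGroup n) :=
  inferInstanceAs (SecondCountableTopology (EuclN n × SOrth n))

instance : BorelSpace (MotionGroup n) :=
  inferInstanceAs (BorelSpace (EuclN n × SOrth n))

instance : SigmaFinite (volume : Measure (MotionGroup n)) :=
  inferInstanceAs (SigmaFinite (volume.prod volume : Measure (EuclN n × SOrth n)))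

instance : (volume : Measure (MotionGroup n)).IsOpenPosMeasure :=
  inferInstanceAs (volume.prod volume : Measure (EuclN n × SOrth n)).IsOpenPosMeasure

instance : IsLocallyFiniteMeasure (volume : Measure (MotionGroup n)) :=
  inferInstanceAs (IsLocallyFiniteMeasure (volume.prod volume : Measure (EuclN n × SOrth n)))

lemma continuous_fst : Continuous fun g : MotionGroup n => g.1 :=
  (_root_.continuous_fst : Continuous (Prod.fst : EuclN n × SOrth n → EuclN n))

lemma isometry_smul (g : MotionGroup n) : Isometry fun v : EuclN n => g • v := by
  refine Isometry.of_dist_eq fun v w => ?_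
  simp only [smul_def, dist_add_left]
  exact g.2.rotIsometry.isometry.dist_eq v w

lemma measurePreserving_smul (g : MotionGroup n) :
    MeasurePreserving fun v : EuclN n => g • v :=
  (measurePreserving_add_left volume g.1).comp g.2.rotIsometry.measurePreserving

instance : SMulInvariantMeasure (MotionGroup n) (EuclN n) volume :=
  ⟨fun g _ hs => (measurePreserving_smul g).measure_preimage hs.nullMeasurableSet⟩

instance : ContinuousConstSMul (MotionGroup n) (EuclN n) :=
  ⟨fun g => (isometry_smul g).continuous⟩

lemma measurePreserving_mul_left (g : MotionGroup n) :
    MeasurePreserving fun h : MotionGroup n => g * h :=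
  MeasurePreserving.prod (measurePreserving_smul g)
    (_root_.MeasureTheory.measurePreserving_mul_left (volume : Measure (SOrth n)) g.2)

instance : (volume : Measure (MotionGroup n)).IsMulLeftInvariant :=
  ⟨fun g => (measurePreserving_mul_left g).map_eq⟩

lemma norm_inv_mul_fst (g h : MotionGroup n) : ‖(h⁻¹ * g).1‖ = ‖g.1 - h.1‖ := by
  have : (h⁻¹ * g).1 = (h.2⁻¹).rot (g.1 - h.1) := by
    rw [sub_eq_neg_add, SOrth.rot_add, SOrth.rot_neg]; rfl
  rw [this, SOrth.norm_rot]

lemma dist_smul_fst (g : MotionGroup n) (v : EuclN n) : dist (g • v) g.1 = ‖v‖ := by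
  rw [smul_def, dist_eq_norm, add_sub_cancel_left, SOrth.norm_rot]

/-- The motions whose translation part lies in the open ball `B(p, r)`, that is,
`B(p, r) × SO(n)`. -/
def cylinder (p : EuclN n) (r : ℝ) : Set (MotionGroup n) := {g | g.1 ∈ Metric.ball p r}

lemma isOpen_cylinder (p : EuclN n) (r : ℝ) : IsOpen (cylinder p r) :=
  Metric.isOpen_ball.preimage continuous_fst

lemma volume_cylinder (p : EuclN n) (r : ℝ) :
    volume (cylinder p r) = volume (Metric.ball p r) := by
  have : cylinder p r = Metric.ball p r ×ˢ (Set.univ : Set (SOrth n)) := by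
    ext g; exact (and_iff_left (Set.mem_univ g.2)).symm
  rw [this]
  refine (Measure.prod_prod (μ := volume) (ν := volume) _ _).trans ?_
  rw [measure_univ, mul_one]

end MotionGroup

/-! ### Functions of positive type on the motion group -/

namespace MotionGroup

variable {n : ℕ} {f : MotionGroup n → ℝ}

lemma IsPositiveType.exists_abs_inv_mul_le (hf_pos : IsPositiveType (fun g => (f g : ℂ))) :
    ∃ C : ℝ, ∀ g h : MotionGroup n, |f (h⁻¹ * g)| ≤ C := by
  obtain ⟨C, hC⟩ := hf_pos.bounded
  exact ⟨C, fun g h => by simpa using hC (h⁻¹ * g)⟩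

lemma continuous_inv_mul_kernel (hf_cont : Continuous f) :
    Continuous (Function.uncurry fun g h : MotionGroup n => f (h⁻¹ * g)) :=
  hf_cont.comp (by fun_prop : Continuous fun z : MotionGroup n × MotionGroup n => z.2⁻¹ * z.1)

/-- For a real test function the positive type condition is the nonnegativity of a single real
integral over `M(n) × M(n)`. -/
lemma IsPositiveType.integral_prod_nonneg (hf_cont : Continuous f)
    (hf_pos : IsPositiveType (fun g => (f g : ℂ))) {ρ : MotionGroup n → ℝ} (hρ : Integrable ρ) :
    0 ≤ ∫ z : MotionGroup n × MotionGroup n, f (z.2⁻¹ * z.1) * (ρ z.1 * ρ z.2)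
      ∂(volume.prod volume) := by
  have hbdd := hf_pos.exists_abs_inv_mul_le
  have hk := continuous_inv_mul_kernel hf_cont
  rw [integral_prod _ (PositiveKernel.integrable_mul hk hbdd hρ hρ)]
  have h := hf_pos.nonneg (fun g => (ρ g : ℂ)) hρ.ofReal
  simp only [Complex.conj_ofReal, ← Complex.ofReal_mul, integral_complex_ofReal] at h
  simpa only [mul_assoc] using Complex.zero_le_real.1 h

lemma integrable_comp_inv_mul (hf : Integrable f) (h : MotionGroup n) :
    Integrable fun g => f (h⁻¹ * g) :=
  hf.comp_mul_left h⁻¹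

/-- The integral of `f (h⁻¹ g)` over all `g` is `∫ f`, and up to `ε` it is attained on any cylinder
that reaches a distance `m` beyond `h` in every direction; `m` depends only on `f` and `ε`. -/
lemma exists_abs_setIntegral_sub_le (hf : Integrable f) {ε : ℝ} (hε : 0 < ε) :
    ∃ m : ℝ, 0 ≤ m ∧ ∀ (p : EuclN n) (R : ℝ) (h : MotionGroup n), dist h.1 p + m ≤ R →
      |(∫ g in cylinder p R, f (h⁻¹ * g)) - ∫ g, f g| ≤ ε := by
  have hm : ∀ (p : EuclN n) (r : ℝ), MeasurableSet (cylinder p r) := fun p r =>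
    (isOpen_cylinder p r).measurableSet
  have hU : (⋃ m : ℕ, cylinder (0 : EuclN n) m) = Set.univ :=
    Set.eq_univ_of_forall fun g => by
      obtain ⟨m, hm⟩ := exists_nat_gt (dist g.1 0)
      exact Set.mem_iUnion.2 ⟨m, hm⟩
  have hlim := tendsto_setIntegral_of_monotone (μ := (volume : Measure (MotionGroup n)))
    (f := fun g => |f g|) (fun m : ℕ => hm 0 m)
    (fun a b hab g hg => Metric.ball_subset_ball (Nat.cast_le.2 hab) hg) (hf.abs.integrableOn)
  rw [hU, setIntegral_univ] at hlim
  obtain ⟨m, hm'⟩ := (hlim.eventually (lt_mem_nhds (sub_lt_self _ hε))).exists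
  have htail : ∫ g in (cylinder (0 : EuclN n) m)ᶜ, |f g| ≤ ε := by
    have := integral_add_compl (hm 0 m) hf.abs
    linarith
  refine ⟨m, m.cast_nonneg, fun p R h hR => ?_⟩
  have hfh := integrable_comp_inv_mul hf h
  have h1 := integral_add_compl (hm p R) hfh
  rw [integral_mul_left_eq_self (μ := volume) f h⁻¹] at h1
  have h2 : (∫ g in cylinder p R, f (h⁻¹ * g)) - ∫ g, f g =
      -∫ g in (cylinder p R)ᶜ, f (h⁻¹ * g) := by linarith
  rw [h2, abs_neg]
  -- If `g` is outside `cylinder p R`, then `g.1` is at distance at least `m` from `h.1`, so that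
  -- `h⁻¹ * g` is outside `cylinder 0 m`.
  refine le_trans (abs_integral_le_integral_abs.trans ?_) htail
  rw [← integral_indicator (hm 0 m).compl, ← integral_indicator (hm p R).compl,
    ← integral_mul_left_eq_self (μ := volume)
      ((cylinder (0 : EuclN n) m)ᶜ.indicator fun g => |f g|) h⁻¹]
  refine integral_mono (hfh.abs.indicator (hm p R).compl)
    (integrable_comp_inv_mul (hf.abs.indicator (hm 0 m).compl) h) fun g => ?_
  by_cases hg : g ∈ cylinder p R
  · simp only [Set.indicator_of_notMem (Set.notMem_compl_iff.2 hg)]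
    exact Set.indicator_nonneg (fun _ _ => abs_nonneg _) _
  · have hg' : h⁻¹ * g ∈ (cylinder (0 : EuclN n) m)ᶜ := by
      intro hlt
      refine hg (show dist g.1 p < R from ?_)
      have hlt' : dist (h⁻¹ * g).1 0 < m := hlt
      rw [dist_zero_right, norm_inv_mul_fst, ← dist_eq_norm] at hlt'
      linarith [dist_triangle g.1 h.1 p]
    rw [Set.indicator_of_mem (Set.mem_compl hg), Set.indicator_of_mem hg']

/-- The counting inequality for the kernel `f (h⁻¹ g)` on the cylinder over `B(p, s + m)`, for a
finite set of motions whose translation parts lie in `B(p, s)`. A point `h` of the cylinder over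
`B(p, s)` sees a mass within `ε` of `∫ f`; over the remaining shell only the bound `∫ |f|` is
available. -/
lemma card_mul_sq_le (hf_int : Integrable f) (hf_cont : Continuous f)
    (hf_pos : IsPositiveType (fun g => (f g : ℂ))) {ε m : ℝ} (hε : 0 ≤ ε) (hm0 : 0 ≤ m)
    (hm : ∀ (p : EuclN n) (R : ℝ) (h : MotionGroup n), dist h.1 p + m ≤ R →
      |(∫ g in cylinder p R, f (h⁻¹ * g)) - ∫ g, f g| ≤ ε)
    (hεf : ε < ∫ g, f g) {p : EuclN n} {s : ℝ} (hs : 0 < s) {F : Finset (MotionGroup n)}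
    (hF : F.Nonempty) (hFs : ∀ a ∈ F, dist a.1 p < s)
    (hoff : ∀ a ∈ F, ∀ b ∈ F, a ≠ b → f (b⁻¹ * a) ≤ 0) :
    F.card * ((∫ g, f g) - ε) ^ 2 ≤ f 1 * (((∫ g, f g) + ε) * volume.real (Metric.ball p (s + m)) +
      (∫ g, |f g|) * (volume.real (Metric.ball p (s + m)) - volume.real (Metric.ball p s))) := by
  have hbdd := hf_pos.exists_abs_inv_mul_le
  have hk := continuous_inv_mul_kernel hf_cont
  have hsymm : ∀ g h : MotionGroup n, f (h⁻¹ * g) = f (g⁻¹ * h) := fun g h => by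
    have := hf_pos.hermitian (h⁻¹ * g)
    rw [Complex.conj_ofReal, Complex.ofReal_inj] at this
    rw [this, mul_inv_rev, inv_inv]
  have hcm : ∀ r : ℝ, MeasurableSet (cylinder p r) := fun r => (isOpen_cylinder p r).measurableSet
  have hcr : ∀ r : ℝ, volume.real (cylinder p r) = volume.real (Metric.ball p r) := fun r => by
    rw [measureReal_def, volume_cylinder, measureReal_def]
  have hcfin : ∀ r : ℝ, volume (cylinder p r) ≠ ∞ := fun r => by
    rw [volume_cylinder]; exact measure_ball_lt_top.ne
  have hL : 0 ≤ ∫ g, |f g| := integral_nonneg fun _ => abs_nonneg _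
  have hsub : Metric.ball p s ⊆ Metric.ball p (s + m) := Metric.ball_subset_ball (by linarith)
  have hV : volume.real (Metric.ball p s) ≤ volume.real (Metric.ball p (s + m)) :=
    measureReal_mono hsub measure_ball_lt_top.ne
  have hVpos : 0 < volume.real (Metric.ball p (s + m)) :=
    ENNReal.toReal_pos (Metric.measure_ball_pos _ _ (by linarith)).ne' measure_ball_lt_top.ne
  refine PositiveKernel.card_mul_sq_le hk hbdd hsymm
    (fun ρ hρ => hf_pos.integral_prod_nonneg hf_cont hρ) hF (fun a _ => by simp) hoff
    (W := cylinder p s) (B := cylinder p (s + m)) (isOpen_cylinder p s) hFs (hcm _)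
    (hcfin _) (sub_nonneg.2 hεf.le) ?_ ?_ ?_
  · intro h hh
    have := hm p (s + m) h (by have : dist h.1 p < s := hh; linarith)
    linarith [(abs_le.1 this).1]
  · have : 0 < (∫ g, f g) + ε := by linarith
    have := sub_nonneg.2 hV
    positivity
  · have hfinite : IsFiniteMeasure (volume.restrict (cylinder p (s + m))) :=
      isFiniteMeasure_restrict.2 (hcfin _)
    obtain ⟨C, hC⟩ := hbdd
    have hJ : Integrable (fun h : MotionGroup n => ∫ g in cylinder p (s + m), f (h⁻¹ * g))
        (volume.restrict (cylinder p (s + m))) :=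
      (Integrable.of_bound (μ := (volume.restrict (cylinder p (s + m))).prod
        (volume.restrict (cylinder p (s + m)))) hk.measurable.aestronglyMeasurable C
        (ae_of_all _ fun z => hC z.1 z.2)).integral_prod_right
    have hind : Integrable ((cylinder p s)ᶜ.indicator fun _ : MotionGroup n => ∫ g, |f g|)
        (volume.restrict (cylinder p (s + m))) := (integrable_const _).indicator (hcm s).compl
    calc _ ≤ ∫ h in cylinder p (s + m), (((∫ g, f g) + ε) +
          (cylinder p s)ᶜ.indicator (fun _ => ∫ g, |f g|) h) := by
          refine integral_mono hJ ((integrable_const _).add hind) fun h => ?_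
          by_cases hh : h ∈ cylinder p s
          · have := hm p (s + m) h (by have : dist h.1 p < s := hh; linarith)
            simp only [Set.indicator_of_notMem (Set.notMem_compl_iff.2 hh)]
            linarith [(abs_le.1 this).2]
          · simp only [Set.indicator_of_mem (Set.mem_compl hh)]
            have h1 : ∫ g in cylinder p (s + m), f (h⁻¹ * g) ≤ ∫ g, |f g| := by
              rw [← integral_mul_left_eq_self (fun g => |f g|) h⁻¹]
              have hi := (integrable_comp_inv_mul hf_int h)
              exact (integral_mono hi.integrableOn hi.abs.integrableOn
                fun g => le_abs_self _).trans
                (setIntegral_le_integral hi.abs (ae_of_all _ fun g => abs_nonneg _))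
            linarith
      _ = _ := by
          rw [integral_add (integrable_const _) hind, integral_const,
            integral_indicator (hcm s).compl, setIntegral_const, measureReal_restrict_apply_univ,
            measureReal_restrict_apply (hcm s).compl, smul_eq_mul, smul_eq_mul]
          have : (cylinder p s)ᶜ ∩ cylinder p (s + m) = cylinder p (s + m) \ cylinder p s := by
            rw [Set.inter_comm]; rfl
          have hcsub : cylinder p s ⊆ cylinder p (s + m) := fun g hg => hsub hg
          rw [this, measureReal_sdiff hcsub (hcm s) (hcfin _), hcr, hcr]
          ring

end MotionGroup

/-! ### Packings and their density -/

namespace MotionGroup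

variable {n : ℕ}

lemma inter_inv_mul_smul_eq_empty {U : Set (EuclN n)} {a b : MotionGroup n}
    (h : Disjoint (a • U) (b • U)) : U ∩ (b⁻¹ * a) • U = ∅ := by
  refine Set.eq_empty_of_forall_notMem ?_
  rintro x ⟨hx, u, hu, hux⟩
  refine Set.disjoint_left.1 h (Set.smul_mem_smul_set hu) ⟨x, hx, ?_⟩
  change b • x = a • u
  rw [← hux, smul_smul, mul_inv_cancel_left]

lemma dist_fst_lt {K : Set (EuclN n)} {D r : ℝ} (hD : ∀ v ∈ K, ‖v‖ ≤ D) {g : MotionGroup n}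
    {p : EuclN n} (hg : (g • K ∩ Metric.ball p r).Nonempty) : dist g.1 p < r + D := by
  obtain ⟨_, ⟨v, hv, rfl⟩, hx⟩ := hg
  have h1 := dist_smul_fst g v
  have h2 : dist (g • v) p < r := hx
  linarith [dist_triangle_left g.1 p (g • v), hD v hv]

end MotionGroup

section

variable {n : ℕ}

lemma volume_real_ball (p : EuclN n) {r : ℝ} (hr : 0 < r) :
    volume.real (Metric.ball p r) = r ^ n * volume.real (Metric.ball (0 : EuclN n) 1) := by
  rw [measureReal_def, Measure.addHaar_ball_of_pos _ _ hr, ENNReal.toReal_mul,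
    ENNReal.toReal_ofReal (by positivity), finrank_euclideanSpace_fin, measureReal_def]

lemma tendsto_add_div_pow (c : ℝ) (n : ℕ) :
    Tendsto (fun r : ℝ => ((r + c) / r) ^ n) atTop (nhds 1) := by
  have h : Tendsto (fun r : ℝ => 1 + c / r) atTop (nhds (1 + 0)) :=
    tendsto_const_nhds.add (tendsto_const_nhds.div_atTop tendsto_id)
  rw [add_zero] at h
  have h' := (h.congr' (f₂ := fun r : ℝ => (r + c) / r) (by
    filter_upwards [eventually_gt_atTop 0] with r hr
    field_simp)).pow n
  rwa [one_pow] at h'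

/-- If no finite family of copies meeting the ball has more than `q` members, then only finitely
many copies meet it, and they cover a volume of at most `q * vol K` of the ball. -/
lemma volume_ball_inter_le {K P : Set (EuclN n)} {S : Set (MotionGroup n)} {v : ℝ}
    (hKv : volume K = ENNReal.ofReal v) (hv : 0 ≤ v)
    (hP : P = ⋃ g ∈ S, g • K) {p : EuclN n} {r q : ℝ}
    (hq : ∀ F : Finset (MotionGroup n), F.Nonempty →
      (∀ g ∈ F, g ∈ S ∧ (g • K ∩ Metric.ball p r).Nonempty) → F.card ≤ q) :
    volume (Metric.ball p r ∩ P) ≤ ENNReal.ofReal (q * v) := by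
  set T : Set (MotionGroup n) := {g | g ∈ S ∧ (g • K ∩ Metric.ball p r).Nonempty} with hT
  have hTfin : T.Finite := by
    by_contra hinf
    obtain ⟨F, hF, hcard⟩ := Set.Infinite.exists_subset_card_eq hinf (⌊q⌋₊ + 1)
    have h1 := hq F (Finset.card_pos.1 (by omega)) fun g hg => hF hg
    rw [hcard] at h1
    push_cast at h1
    linarith [Nat.lt_floor_add_one q]
  have hsub : Metric.ball p r ∩ P ⊆ ⋃ g ∈ hTfin.toFinset, g • K := by
    rintro x ⟨hx, hxP⟩
    rw [hP] at hxP
    obtain ⟨g, hg, hxg⟩ := Set.mem_iUnion₂.1 hxP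
    exact Set.mem_iUnion₂.2 ⟨g, hTfin.mem_toFinset.2 ⟨hg, x, hxg, hx⟩, hxg⟩
  calc volume (Metric.ball p r ∩ P) ≤ ∑ g ∈ hTfin.toFinset, volume (g • K) :=
        (measure_mono hsub).trans (measure_biUnion_finset_le _ _)
    _ = ENNReal.ofReal (hTfin.toFinset.card * v) := by
        simp only [measure_smul, hKv, Finset.sum_const, nsmul_eq_mul]
        rw [ENNReal.ofReal_mul (Nat.cast_nonneg _), ENNReal.ofReal_natCast]
    _ ≤ ENNReal.ofReal (q * v) := by
        rcases hTfin.toFinset.eq_empty_or_nonempty with h | h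
        · simp [h]
        · exact ENNReal.ofReal_le_ofReal (mul_le_mul_of_nonneg_right
            (hq _ h fun g hg => hTfin.mem_toFinset.1 hg) hv)

lemma HasDensity.le_upperDensity {P : Set (EuclN n)} {Δ : ℝ≥0∞} (h : HasDensity P Δ) :
    Δ ≤ upperDensity P := by
  rw [← (h 0).limsup_eq]
  exact limsup_le_limsup (Eventually.of_forall fun r =>
    le_iSup (fun p : EuclN n => volume (Metric.ball p r ∩ P) / volume (Metric.ball p r)) 0)

/-- The density bound with a loss of `ε`: the counting inequality for the copies that meet
`B(p, r)`, divided by the volume of the ball, in the limit `r → ∞`. -/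
lemma upperDensity_le_of_pos_lt_integral (K : ConvexBody (EuclN n)) {f : MotionGroup n → ℝ}
    (hf_int : Integrable f volume) (hf_cont : Continuous f)
    (hf_pos : MotionGroup.IsPositiveType (fun g => (f g : ℂ)))
    (hf_nonpos : ∀ g : MotionGroup n,
      interior (K : Set (EuclN n)) ∩ g • interior (K : Set (EuclN n)) = ∅ → f g ≤ 0)
    {P : Set (EuclN n)} (hP : IsPacking (K : Set (EuclN n)) P) {ε : ℝ} (hε : 0 < ε)
    (hεf : ε < ∫ g, f g) :
    upperDensity P ≤ ENNReal.ofReal (f 1 * ((∫ g, f g) + ε) / ((∫ g, f g) - ε) ^ 2 *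
      volume.real (K : Set (EuclN n))) := by
  obtain ⟨S, hS, hPS⟩ := hP
  obtain ⟨m, hm0, hm⟩ := MotionGroup.exists_abs_setIntegral_sub_le hf_int hε
  obtain ⟨D, hD0, hD⟩ : ∃ D : ℝ, 0 ≤ D ∧ ∀ v ∈ (K : Set (EuclN n)), ‖v‖ ≤ D := by
    obtain ⟨D, hD⟩ := K.isCompact.isBounded.exists_norm_le
    exact ⟨max D 0, le_max_right _ _, fun v hv => (hD v hv).trans (le_max_left _ _)⟩
  set l := ∫ g, f g with hl
  set L := ∫ g, |f g| with hL
  set v := volume.real (K : Set (EuclN n)) with hv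
  have hKv : volume (K : Set (EuclN n)) = ENNReal.ofReal v :=
    (ENNReal.ofReal_toReal K.isCompact.measure_lt_top.ne).symm
  set ω := volume.real (Metric.ball (0 : EuclN n) 1) with hω
  have hlε : 0 < l - ε := sub_pos.2 hεf
  -- Copies meeting `B(p, r)` have their translation part in `B(p, r + D)`; the test cylinder lies
  -- over `B(p, r + D + m)`, and the three volumes agree asymptotically.
  let A : ℝ → ℝ := fun r => f 1 * ((l + ε) * ((r + (D + m)) / r) ^ n +
    L * (((r + (D + m)) / r) ^ n - ((r + D) / r) ^ n)) / (l - ε) ^ 2 * v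
  have hA : Tendsto A atTop (nhds (f 1 * (l + ε) / (l - ε) ^ 2 * v)) := by
    have h1 := tendsto_add_div_pow (D + m) n
    have h2 := tendsto_add_div_pow D n
    have h3 := ((((h1.const_mul (l + ε)).add ((h1.sub h2).const_mul L)).const_mul
      (f 1)).div_const ((l - ε) ^ 2)).mul_const v
    simpa using h3
  have hbound : ∀ r : ℝ, 0 < r → ∀ p : EuclN n,
      volume (Metric.ball p r ∩ P) / volume (Metric.ball p r) ≤ ENNReal.ofReal (A r) := by
    intro r hr p
    refine ENNReal.div_le_of_le_mul ?_
    have hball : volume (Metric.ball p r) = ENNReal.ofReal (r ^ n * ω) := by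
      rw [← volume_real_ball p hr, measureReal_def,
        ENNReal.ofReal_toReal measure_ball_lt_top.ne]
    rw [hball, ← ENNReal.ofReal_mul' (by positivity)]
    have hAr : A r * (r ^ n * ω) = f 1 * ((l + ε) * ((r + D + m) ^ n * ω) +
        L * ((r + D + m) ^ n * ω - (r + D) ^ n * ω)) / (l - ε) ^ 2 * v := by
      simp only [A, div_pow, add_assoc]
      field_simp
    rw [hAr]
    refine volume_ball_inter_le hKv measureReal_nonneg hPS fun F hF hFS => ?_
    rw [le_div_iff₀ (by positivity)]
    have := MotionGroup.card_mul_sq_le hf_int hf_cont hf_pos hε.le hm0 hm hεf (p := p)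
      (s := r + D) (by linarith) hF
      (fun a ha => MotionGroup.dist_fst_lt hD (hFS a ha).2)
      fun a ha b hb hab => hf_nonpos _ (MotionGroup.inter_inv_mul_smul_eq_empty (by
        rw [← interior_smul, ← interior_smul]
        exact hS (hFS a ha).1 (hFS b hb).1 hab))
    rwa [volume_real_ball p (by linarith), volume_real_ball p (by linarith)] at this
  calc upperDensity P ≤ limsup (fun r => ENNReal.ofReal (A r)) atTop := by
        refine limsup_le_limsup ?_
        filter_upwards [eventually_gt_atTop 0] with r hr
        exact iSup_le (hbound r hr)
    _ = _ := (ENNReal.tendsto_ofReal hA).limsup_eq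

end

theorem theorem1 (n : ℕ) (K : ConvexBody (EuclideanSpace ℝ (Fin n)))
    (f : MotionGroup n → ℝ)
    (hf_int : Integrable f volume)
    (hf_bdd : ∃ C : ℝ, ∀ g, |f g| ≤ C)
    (hf_cont : Continuous f)
    (hf_pos : MotionGroup.IsPositiveType (fun g => (f g : ℂ)))
    (hf_nonpos : ∀ g : MotionGroup n,
      interior (K : Set (EuclideanSpace ℝ (Fin n))) ∩
        g • interior (K : Set (EuclideanSpace ℝ (Fin n))) = ∅ → f g ≤ 0)
    (hf_lam : 0 < ∫ g, f g)
    (P : Set (EuclideanSpace ℝ (Fin n)))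
    (hP : IsPacking (K : Set (EuclideanSpace ℝ (Fin n))) P) :
    upperDensity P ≤ ENNReal.ofReal
        (f 1 / (∫ g, f g) * volume.real (K : Set (EuclideanSpace ℝ (Fin n)))) ∧
      ∀ Δ : ENNReal, HasDensity P Δ →
        Δ ≤ ENNReal.ofReal
          (f 1 / (∫ g, f g) * volume.real (K : Set (EuclideanSpace ℝ (Fin n)))) := by
  have key : upperDensity P ≤ ENNReal.ofReal
      (f 1 / (∫ g, f g) * volume.real (K : Set (EuclideanSpace ℝ (Fin n)))) := by
    set l := ∫ g, f g with hl
    set v := volume.real (K : Set (EuclideanSpace ℝ (Fin n))) with hv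
    have hlim : Tendsto (fun ε : ℝ => f 1 * (l + ε) / (l - ε) ^ 2 * v) (nhdsWithin 0 (Set.Ioi 0))
        (nhds (f 1 / l * v)) := by
      have hc : ContinuousAt (fun ε : ℝ => f 1 * (l + ε) / (l - ε) ^ 2 * v) 0 := by
        have : (l - 0) ^ 2 ≠ 0 := by rw [sub_zero]; positivity
        fun_prop (disch := assumption)
      have he : f 1 * (l + 0) / (l - 0) ^ 2 * v = f 1 / l * v := by
        rw [add_zero, sub_zero]; field_simp
      rw [← he]
      exact hc.tendsto.mono_left nhdsWithin_le_nhds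
    refine ge_of_tendsto (ENNReal.tendsto_ofReal hlim) ?_
    filter_upwards [Ioo_mem_nhdsGT hf_lam] with ε hε
    exact upperDensity_le_of_pos_lt_integral K hf_int hf_cont hf_pos hf_nonpos hP hε.1 hε.2
  exact ⟨key, fun Δ hΔ => hΔ.le_upperDensity.trans key⟩
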